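/- A tile (type) over a glue alphabet $\Sigma$ is a $4$-tuple of glues (north, east, south, west side). A hierarchical tile assembly system is a triple $\mathcal{T}=(T,\tau,\mathrm{str})$ with $T$ a finite set of tile types, $\tau\in\mathbb{N}$ the temperature, and $\mathrm{str}:\Sigma\times\Sigma\to\mathbb{N}$ the interaction strength. An assembly is a partial map $\alpha:\mathbb{Z}^2\dashrightarrow T$ whose domain induces a connected subgraph of the square lattice. A lattice edge between two points of $\operatorname{dom}\alpha$ has weight equal to the interaction strength of the two glues on the abutting sides of the tiles at its end-points (if $\mathrm{str}$ is not symmetric, the glues are taken in the order west to east, respectively south to north). An assembly is producible in $\mathcal{T}$ if its domain is a single point, or if it is the union of two producible assemblies with disjoint domains such that the edges between the two domains have total weight at least $\tau$ (the producible assemblies are the smallest class with this property; in particular they are finite). For $\vec v\in\mathbb{Z}^2$ let $\alpha+\vec v$ be the assembly with domain $\operatorname{dom}\alpha+\vec v$ and $(\alpha+\vec v)(p)=\alpha(p-\vec v)$. An assembly $\alpha$ is repetitious if there is a nonzero $\vec v\in\mathbb{Z}^2$ such that $\operatorname{dom}\alpha\cap\operatorname{dom}(\alpha+\vec v)\neq\emptyset$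 and $\alpha(p)=(\alpha+\vec v)(p)$ for all $p$ in this intersection. Theorem. Let $\mathcal{T}$ be a hierarchical tile assembly system. If some assembly producible in $\mathcal{T}$ is repetitious, then arbitrarily large assemblies are producible in $\mathcal{T}$: for every $n\in\mathbb{N}$ there is an assembly $\gamma$ producible in $\mathcal{T}$ with $|\operatorname{dom}\gamma|>n$. -/

import Mathlib

namespace TileAssembly

/-- The square lattice: vertex set `ℤ × ℤ`, edges between points at distance one. -/
def lattice : SimpleGraph (ℤ × ℤ) where
  Adj p q := |p.1 - q.1| + |p.2 - q.2| = 1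
  symm := ⟨fun p q h => by rw [abs_sub_comm q.1, abs_sub_comm q.2]; exact h⟩
  loopless := ⟨fun p h => by simp at h⟩

/-- A tile (type) over the glue alphabet `G`: the glues on its four sides. -/
@[ext]
structure Tile (G : Type*) where
  north : G
  east : G
  south : G
  west : G

/-- A hierarchical tile assembly system: a finite set of tile types, a temperature and an
interaction strength for pairs of glues. -/
structure HierarchicalTAS (G : Type*) where
  tiles : Finset (Tile G)
  temperature : ℕ
  str : G → G → ℕ

/-- An assembly on the set `T` of tiles: a partial map from `ℤ × ℤ` to `T` whose domain induces a
connected subgraph of the lattice. -/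
@[ext]
structure Assembly {G : Type*} (T : Finset (Tile G)) where
  tile : ℤ × ℤ → Option T
  connected : (lattice.induce {p | (tile p).isSome}).Connected

namespace Assembly

variable {G : Type*} {T : Finset (Tile G)}

/-- The domain of an assembly. -/
def dom (α : Assembly T) : Set (ℤ × ℤ) := {p | (α.tile p).isSome}

/-- Two assemblies do not overlap. -/
def Nonoverlapping (α β : Assembly T) : Prop := α.dom ∩ β.dom = ∅

/-- Two assemblies are consistent if they agree wherever both are defined. -/
def Consistent (α β : Assembly T) : Prop := ∀ p ∈ α.dom ∩ β.dom, α.tile p = β.tile p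

/-- `γ` is the union of the (consistent) assemblies `α` and `β`. -/
def IsUnion (γ α β : Assembly T) : Prop :=
  γ.dom = α.dom ∪ β.dom ∧ (∀ p ∈ α.dom, γ.tile p = α.tile p) ∧ ∀ p ∈ β.dom, γ.tile p = β.tile p

/-- An assembly is singular if it consists of one tile. -/
def Singular (γ : Assembly T) : Prop := γ.dom.ncard = 1

/-- The translation `α + v`, with `(α + v)(p) = α(p - v)`. -/
def translate (α : Assembly T) (v : ℤ × ℤ) : Assembly T where
  tile p := α.tile (p - v)
  connected := by
    let e : lattice.induce {p | (α.tile p).isSome} ≃g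
        lattice.induce {p | (α.tile (p - v)).isSome} :=
      { toEquiv := (Equiv.addRight v).subtypeEquiv (fun p => by simp)
        map_rel_iff' := by
          intro a b
          simp [lattice, Equiv.subtypeEquiv] }
    exact e.connected_iff.mp α.connected

/-- An assembly is repetitious if it overlaps, and is consistent with, its translation by some
nonzero integer vector. -/
def Repetitious (α : Assembly T) : Prop :=
  ∃ v : ℤ × ℤ, v ≠ 0 ∧ (α.dom ∩ (α.translate v).dom).Nonempty ∧ α.Consistent (α.translate v)

/-- The weight of the lattice edge `pq` in the assembly `γ`: the interaction strength of the glues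
on the abutting sides of the tiles at `p` and `q` (and `0` if `pq` is not an edge of the graph of
`γ`). The edge is read from west to east or from south to north, so the weight does not depend on
the order of `p` and `q`, and `str` need not be assumed symmetric; if `str` is symmetric, the
reading direction is immaterial. -/
def edgeWeight (str : G → G → ℕ) (γ : Assembly T) (p q : ℤ × ℤ) : ℕ :=
  match γ.tile p, γ.tile q with
  | some s, some t =>
    if q = p + (1, 0) then str s.1.east t.1.west
    else if q = p + (0, 1) then str s.1.north t.1.south
    else if p = q + (1, 0) then str t.1.east s.1.west
    else if p = q + (0, 1) then str t.1.north s.1.south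
    else 0
  | _, _ => 0

/-- The edges of the lattice with one end-point in `dom α` and the other one in `dom β`, each
written as a pair whose first entry is the end-point in `dom α`. -/
def cut (α β : Assembly T) : Set ((ℤ × ℤ) × (ℤ × ℤ)) :=
  {e | e.1 ∈ α.dom ∧ e.2 ∈ β.dom ∧ lattice.Adj e.1 e.2}

/-- A set `C` of edges of `γ` is `τ`-stable if the sum of its weights is at least `τ`. The weights
are natural numbers, so this means that finitely many edges of `C` have total weight at least `τ`
(if `C` is finite, one may take all of `C`). -/
def StableEdges (str : G → G → ℕ) (τ : ℕ) (γ : Assembly T) (C : Set ((ℤ × ℤ) × (ℤ × ℤ))) : Prop :=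
  ∃ F : Finset ((ℤ × ℤ) × (ℤ × ℤ)), (F : Set ((ℤ × ℤ) × (ℤ × ℤ))) ⊆ C ∧
    τ ≤ ∑ e ∈ F, γ.edgeWeight str e.1 e.2

end Assembly

/-- The producible assemblies of a hierarchical tile assembly system: the single tiles, and the
unions of two nonoverlapping producible assemblies whose cut is stable at the temperature of the
system. -/
inductive HierarchicalTAS.Producible {G : Type*} (𝒯 : HierarchicalTAS G) :
    Assembly 𝒯.tiles → Prop
  | singular (γ : Assembly 𝒯.tiles) (h : γ.Singular) : 𝒯.Producible γ
  | union (α β γ : Assembly 𝒯.tiles) (hα : 𝒯.Producible α) (hβ : 𝒯.Producible β)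
      (hd : α.Nonoverlapping β) (hγ : γ.IsUnion α β)
      (hs : γ.StableEdges 𝒯.str 𝒯.temperature (α.cut β)) : 𝒯.Producible γ

end TileAssembly

namespace TileAssembly

/-! Let `α` be producible and agree with `α + v` where they overlap, and let `A` be its domain.
Attaching all of `α + v` may destroy repetitiousness, since `α + 2v` may clash with `α`. Instead,
only `D + v` is attached, where `D` is a connected component of `{p ∈ A | p + v ∉ A}` such that `D +
2v` misses `A`. The new tiles then cause no conflict under translation by `v`, so the larger
assembly is repetitious with the same `v`, and the step can be iterated. That this partial
attachment is producible is `exists_union_inter`.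

The existence of `D` is `exists_component_add_two_smul_notMem`. If every component failed, each
point of `A` that is last in direction `v` would lead, by steps through last points and then a jump
by at least `2v`, to another last point. By finiteness such moves close up into a cycle. Undoing the
jumps turns the cycle into a lattice walk that is periodic up to a multiple `-Mv`, `M ≥ 2`. The
planar chord theorem `periodic_chord` gives two points of the walk differing by `-v`. The jumps
between them then add up to exactly one `v`, although every nonzero jump is at least two.

The chord theorem is a winding number argument, with `crossing` as a discrete angle around the
origin. -/

/-! ### Crossing numbers on the lattice -/

theorem lattice_adj_iff {p q : ℤ × ℤ} : lattice.Adj p q ↔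
    (q.1 = p.1 + 1 ∧ q.2 = p.2) ∨ (q.1 = p.1 - 1 ∧ q.2 = p.2) ∨
    (q.1 = p.1 ∧ q.2 = p.2 + 1) ∨ (q.1 = p.1 ∧ q.2 = p.2 - 1) := by
  change |p.1 - q.1| + |p.2 - q.2| = 1 ↔ _
  grind

/-- The signed number of times the lattice edge from `p` to `q` crosses the ray that starts at
`(1/2, 1/2)` and points east. -/
def crossing (p q : ℤ × ℤ) : ℤ :=
  if p.2 = 0 ∧ q.2 = 1 ∧ 1 ≤ p.1 then 1 else if p.2 = 1 ∧ q.2 = 0 ∧ 1 ≤ p.1 then -1 else 0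

theorem crossing_add_crossing_swap {p q : ℤ × ℤ} (h : lattice.Adj p q) :
    crossing p q + crossing q p = 0 := by
  rw [lattice_adj_iff] at h
  unfold crossing
  split_ifs <;> omega

theorem crossing_eq_zero {p q : ℤ × ℤ} (h : q.2 = p.2) : crossing p q = 0 := by
  unfold crossing
  split_ifs <;> omega

theorem crossing_up {p q : ℤ × ℤ} (h : q.2 = p.2 + 1) :
    crossing p q = if p.2 = 0 ∧ 1 ≤ p.1 then 1 else 0 := by
  unfold crossing
  split_ifs <;> omega

theorem crossing_down {p q : ℤ × ℤ} (h : q.2 = p.2 - 1) :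
    crossing p q = if p.2 = 1 ∧ 1 ≤ p.1 then -1 else 0 := by
  unfold crossing
  split_ifs <;> omega

/-- `crossing` is closed on the (possibly degenerate) squares that do not have the origin as a
vertex. -/
theorem crossing_square {p q r s : ℤ × ℤ} (hp : p ≠ 0) (hq : q ≠ 0) (hr : r ≠ 0) (hs : s ≠ 0)
    (hpq : lattice.Adj p q) (hpr : lattice.Adj p r) (h : p + s = q + r) :
    crossing p q + crossing q s = crossing p r + crossing r s := by
  have hne : ∀ p : ℤ × ℤ, p ≠ 0 → p.1 ≠ 0 ∨ p.2 ≠ 0 := fun p hp => by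
    by_contra! h'; exact hp (Prod.ext h'.1 h'.2)
  replace hp := hne p hp
  replace hq := hne q hq
  replace hr := hne r hr
  replace hs := hne s hs
  have h1 : p.1 + s.1 = q.1 + r.1 := congrArg Prod.fst h
  have h2 : p.2 + s.2 = q.2 + r.2 := congrArg Prod.snd h
  clear h hne
  rw [lattice_adj_iff] at hpq hpr
  rcases hpq with ⟨ha, hb⟩ | ⟨ha, hb⟩ | ⟨ha, hb⟩ | ⟨ha, hb⟩
  · rw [crossing_eq_zero hb, crossing_eq_zero (p := r) (by omega)]
    rcases hpr with ⟨hc, hd⟩ | ⟨hc, hd⟩ | ⟨hc, hd⟩ | ⟨hc, hd⟩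
    · rw [crossing_eq_zero hd, crossing_eq_zero (p := q) (by omega)]
    · rw [crossing_eq_zero hd, crossing_eq_zero (p := q) (by omega)]
    · rw [crossing_up hd, crossing_up (p := q) (by omega)]
      split_ifs <;> omega
    · rw [crossing_down hd, crossing_down (p := q) (by omega)]
      split_ifs <;> omega
  · rw [crossing_eq_zero hb, crossing_eq_zero (p := r) (by omega)]
    rcases hpr with ⟨hc, hd⟩ | ⟨hc, hd⟩ | ⟨hc, hd⟩ | ⟨hc, hd⟩
    · rw [crossing_eq_zero hd, crossing_eq_zero (p := q) (by omega)]
    · rw [crossing_eq_zero hd, crossing_eq_zero (p := q) (by omega)]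
    · rw [crossing_up hd, crossing_up (p := q) (by omega)]
      split_ifs <;> omega
    · rw [crossing_down hd, crossing_down (p := q) (by omega)]
      split_ifs <;> omega
  · rw [crossing_up hb, crossing_up (p := r) (by omega)]
    rcases hpr with ⟨hc, hd⟩ | ⟨hc, hd⟩ | ⟨hc, hd⟩ | ⟨hc, hd⟩
    · rw [crossing_eq_zero hd, crossing_eq_zero (p := q) (by omega)]
      split_ifs <;> omega
    · rw [crossing_eq_zero hd, crossing_eq_zero (p := q) (by omega)]
      split_ifs <;> omega
    · rw [crossing_up hd, crossing_up (p := q) (by omega)]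
      split_ifs <;> omega
    · rw [crossing_down hd, crossing_down (p := q) (by omega)]
      split_ifs <;> omega
  · rw [crossing_down hb, crossing_down (p := r) (by omega)]
    rcases hpr with ⟨hc, hd⟩ | ⟨hc, hd⟩ | ⟨hc, hd⟩ | ⟨hc, hd⟩
    · rw [crossing_eq_zero hd, crossing_eq_zero (p := q) (by omega)]
      split_ifs <;> omega
    · rw [crossing_eq_zero hd, crossing_eq_zero (p := q) (by omega)]
      split_ifs <;> omega
    · rw [crossing_up hd, crossing_up (p := q) (by omega)]
      split_ifs <;> omega
    · rw [crossing_down hd, crossing_down (p := q) (by omega)]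
      split_ifs <;> omega

/-- On the lattice points on or below a line through the origin of nonnegative slope, `crossing` is
the coboundary of the indicator of the upper half plane. -/
theorem crossing_of_det_nonpos {v p q : ℤ × ℤ} (h1 : 0 < v.1) (h2 : 0 ≤ v.2)
    (hpq : lattice.Adj p q) (hp : v.1 * p.2 - v.2 * p.1 ≤ 0) (hq : v.1 * q.2 - v.2 * q.1 ≤ 0) :
    crossing p q = (if 1 ≤ q.2 then 1 else 0) - (if 1 ≤ p.2 then 1 else 0) := by
  -- Below the line, an edge between heights 0 and 1 always meets the ray.
  have hp' : 1 ≤ p.2 → 1 ≤ p.1 := fun h => by by_contra! h'; nlinarith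
  have hq' : 1 ≤ q.2 → 1 ≤ q.1 := fun h => by by_contra! h'; nlinarith
  rw [lattice_adj_iff] at hpq
  unfold crossing
  split_ifs <;> omega

/-- On the nonzero lattice points on or above a line through the origin of nonnegative slope,
`crossing` is the coboundary of the indicator of the complement of a quadrant. -/
theorem crossing_of_det_nonneg {v p q : ℤ × ℤ} (h1 : 0 < v.1) (h2 : 0 ≤ v.2)
    (hpq : lattice.Adj p q) (hp0 : p ≠ 0) (hq0 : q ≠ 0)
    (hp : 0 ≤ v.1 * p.2 - v.2 * p.1) (hq : 0 ≤ v.1 * q.2 - v.2 * q.1) :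
    crossing p q = (if q.2 ≤ 0 ∧ 1 ≤ q.1 then 0 else 1) - (if p.2 ≤ 0 ∧ 1 ≤ p.1 then 0 else 1) := by
  have hp' : 1 ≤ p.1 → 0 ≤ p.2 := fun h => by by_contra! h'; nlinarith
  have hq' : 1 ≤ q.1 → 0 ≤ q.2 := fun h => by by_contra! h'; nlinarith
  -- The origin must be excluded: for `v.2 = 0`, the edge from it to `(1, 0)` changes the indicator
  -- without crossing the ray.
  have hp1 : p.1 ≠ 0 ∨ p.2 ≠ 0 := by
    by_contra! h; exact hp0 (Prod.ext h.1 h.2)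
  have hq1 : q.1 ≠ 0 ∨ q.2 ≠ 0 := by
    by_contra! h; exact hq0 (Prod.ext h.1 h.2)
  rw [lattice_adj_iff] at hpq
  unfold crossing
  split_ifs <;> omega

/-! ### Chords of periodic lattice walks -/

theorem lattice_adj_add_right {p q : ℤ × ℤ} (h : lattice.Adj p q) (r : ℤ × ℤ) :
    lattice.Adj (p + r) (q + r) := by
  rw [lattice_adj_iff] at *
  simp only [Prod.fst_add, Prod.snd_add]
  omega

theorem lattice_adj_sub_left {p q : ℤ × ℤ} (h : lattice.Adj p q) (r : ℤ × ℤ) :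
    lattice.Adj (r - p) (r - q) := by
  rw [lattice_adj_iff] at *
  simp only [Prod.fst_sub, Prod.snd_sub]
  omega

/-- Without a chord, the differences `F i j` avoid the origin. For fixed `i` they trace a path from
`-v` to `(M - 1) • v`, on opposite sides of the origin because `2 ≤ M`. Changing `i` is a homotopy,
so the crossing number `T i` is constant. Yet the path runs on or below the line through `v` when `w
i` maximizes `ℓ`, and on or above it when `w i` minimizes `ℓ`, and these crossing numbers differ by
one. -/
theorem periodic_chord_of_quadrant {v : ℤ × ℤ} (h1 : 0 < v.1) (h2 : 0 ≤ v.2) {w : ℕ → ℤ × ℤ}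
    (hw : ∀ k, lattice.Adj (w k) (w (k + 1))) {L : ℕ} {M : ℤ} (hL : 0 < L) (hM : 2 ≤ M)
    (hper : ∀ k, w (k + L) = w k + M • v) : ∃ i j, w j = w i + v := by
  by_contra! hno
  let F : ℕ → ℕ → ℤ × ℤ := fun i j => w j - w i - v
  have hF0 : ∀ i j, F i j ≠ 0 := fun i j h => hno i j (by
    have : w j - (w i + v) = 0 := by rw [← h]; simp only [F]; abel
    exact sub_eq_zero.mp this)
  have hFj : ∀ i j, lattice.Adj (F i j) (F i (j + 1)) := fun i j => by
    have := lattice_adj_add_right (hw j) (- w i - v)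
    convert this using 1 <;> simp only [F] <;> abel
  have hFi : ∀ i j, lattice.Adj (F i j) (F (i + 1) j) := fun i j => by
    have := lattice_adj_sub_left (hw i) (w j - v)
    convert this using 1 <;> simp only [F] <;> abel
  have hstart : ∀ i, F i i = -v := fun i => by simp [F]
  have hend : ∀ i, F i (i + L) = (M - 1) • v := fun i => by
    simp only [F, hper, sub_smul, one_smul]; abel
  let T : ℕ → ℤ := fun i => ∑ k ∈ Finset.range L, crossing (F i (i + k)) (F i (i + k + 1))
  have hT : ∀ i, T (i + 1) = T i := fun i => by
    have hsq : ∀ j, crossing (F i j) (F i (j + 1)) - crossing (F (i + 1) j) (F (i + 1) (j + 1))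
        = crossing (F i j) (F (i + 1) j) - crossing (F i (j + 1)) (F (i + 1) (j + 1)) := fun j => by
      have := crossing_square (hF0 i j) (hF0 i (j + 1)) (hF0 (i + 1) j) (hF0 (i + 1) (j + 1))
        (hFj i j) (hFi i j) (by simp only [F]; abel)
      linarith
    have hsum : T i - ∑ k ∈ Finset.range L, crossing (F (i + 1) (i + k)) (F (i + 1) (i + k + 1))
        = crossing (F i i) (F (i + 1) i) - crossing (F i (i + L)) (F (i + 1) (i + L)) := by
      simp only [T]
      rw [← Finset.sum_sub_distrib, Finset.sum_congr rfl (fun k _ => hsq (i + k))]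
      exact Finset.sum_range_sub' (fun k => crossing (F i (i + k)) (F (i + 1) (i + k))) L
    -- The window of summation moves from `i` to `i + 1`; the edges lost and gained at its ends
    -- cancel the side edges of the strip of squares.
    have hshift : T (i + 1) + crossing (F (i + 1) i) (F (i + 1) (i + 1)) =
        ∑ k ∈ Finset.range L, crossing (F (i + 1) (i + k)) (F (i + 1) (i + k + 1)) +
          crossing (F (i + 1) (i + L)) (F (i + 1) (i + L + 1)) := by
      rw [← Finset.sum_range_succ (fun k => crossing (F (i + 1) (i + k)) (F (i + 1) (i + k + 1))),
        Finset.sum_range_succ']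
      simp only [T, add_zero, Nat.add_assoc, Nat.add_comm 1]
    have ha := crossing_add_crossing_swap (hFi i i)
    have hb := crossing_add_crossing_swap (hFi i (i + L))
    have hc : F (i + 1) (i + 1) = F i i := by rw [hstart, hstart]
    have hd : F (i + 1) (i + L + 1) = F i (i + L) := by
      rw [hend, show i + L + 1 = i + 1 + L by ring, hend]
    rw [hc, hd] at hshift
    linarith
  have hTconst : ∀ i, T i = T 0 := fun i => by
    induction i with
    | zero => rfl
    | succ i ih => rw [hT, ih]
  let ℓ : ℤ × ℤ → ℤ := fun p => v.1 * p.2 - v.2 * p.1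
  have hℓ : ∀ i j, ℓ (F i j) = ℓ (w j) - ℓ (w i) := fun i j => by
    simp only [ℓ, F, Prod.fst_sub, Prod.snd_sub]; ring
  have hℓper : ∀ k, ℓ (w k) = ℓ (w (k % L)) := fun k => by
    induction k using Nat.strong_induction_on with
    | _ k ih =>
      rcases lt_or_ge k L with h | h
      · rw [Nat.mod_eq_of_lt h]
      · obtain ⟨m, rfl⟩ := Nat.exists_eq_add_of_le' h
        rw [Nat.add_mod_right, ← ih m (by omega), hper]
        simp only [ℓ, Prod.fst_add, Prod.snd_add, Prod.smul_fst, Prod.smul_snd, smul_eq_mul]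
        ring
  have hne : (Finset.range L).Nonempty := Finset.nonempty_range_iff.mpr hL.ne'
  obtain ⟨t, -, ht⟩ := Finset.exists_max_image (Finset.range L) (fun k => ℓ (w k)) hne
  obtain ⟨b, -, hb⟩ := Finset.exists_min_image (Finset.range L) (fun k => ℓ (w k)) hne
  have ht' : ∀ j, ℓ (F t j) ≤ 0 := fun j => by
    have := ht (j % L) (Finset.mem_range.mpr (Nat.mod_lt _ hL))
    rw [hℓ, hℓper j]; linarith
  have hb' : ∀ j, 0 ≤ ℓ (F b j) := fun j => by
    have := hb (j % L) (Finset.mem_range.mpr (Nat.mod_lt _ hL))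
    rw [hℓ, hℓper j]; linarith
  have hTt : T t = (if 1 ≤ ((M - 1) • v).2 then 1 else 0) - (if 1 ≤ (-v).2 then 1 else 0) := by
    simp only [T]
    rw [Finset.sum_congr rfl (fun k _ =>
      crossing_of_det_nonpos h1 h2 (hFj t (t + k)) (ht' _) (ht' _)), ← hend t, ← hstart t]
    exact Finset.sum_range_sub (fun k => if 1 ≤ (F t (t + k)).2 then (1 : ℤ) else 0) L
  have hTb : T b = (if ((M - 1) • v).2 ≤ 0 ∧ 1 ≤ ((M - 1) • v).1 then 0 else 1) -
      (if (-v).2 ≤ 0 ∧ 1 ≤ (-v).1 then 0 else 1) := by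
    simp only [T]
    rw [Finset.sum_congr rfl (fun k _ =>
      crossing_of_det_nonneg h1 h2 (hFj b (b + k)) (hF0 _ _) (hF0 _ _) (hb' _) (hb' _)),
      ← hend b, ← hstart b]
    exact Finset.sum_range_sub
      (fun k => if (F b (b + k)).2 ≤ 0 ∧ 1 ≤ (F b (b + k)).1 then (0 : ℤ) else 1) L
  have hTT : T t = T b := by rw [hTconst t, hTconst b]
  rw [hTt, hTb] at hTT
  have h3 : 0 < (M - 1) * v.1 := mul_pos (by omega) h1
  have h4 : v.2 = 0 ∨ 1 ≤ v.2 ∧ 1 ≤ (M - 1) * v.2 := by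
    rcases h2.eq_or_lt with h | h
    · exact Or.inl h.symm
    · exact Or.inr ⟨h, mul_pos (by omega) h⟩
  simp only [Prod.smul_fst, Prod.smul_snd, smul_eq_mul, Prod.fst_neg, Prod.snd_neg] at hTT
  rcases h4 with h4 | ⟨h4, h5⟩
  · simp only [h4, mul_zero] at hTT
    split_ifs at hTT <;> omega
  · split_ifs at hTT <;> omega

/-- Quarter turns carry every nonzero `v` into the half-open quadrant treated above. -/
theorem periodic_chord_of_rotate {v : ℤ × ℤ}
    (H : ∀ (w : ℕ → ℤ × ℤ), (∀ k, lattice.Adj (w k) (w (k + 1))) → ∀ (L : ℕ) (M : ℤ), 0 < L →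
      2 ≤ M → (∀ k, w (k + L) = w k + M • (-v.2, v.1)) → ∃ i j, w j = w i + (-v.2, v.1))
    (w : ℕ → ℤ × ℤ) (hw : ∀ k, lattice.Adj (w k) (w (k + 1))) (L : ℕ) (M : ℤ) (hL : 0 < L)
    (hM : 2 ≤ M) (hper : ∀ k, w (k + L) = w k + M • v) : ∃ i j, w j = w i + v := by
  obtain ⟨i, j, hij⟩ := H (fun k => (-(w k).2, (w k).1))
    (fun k => by
      have := hw k
      rw [lattice_adj_iff] at this ⊢
      simp only
      omega) L M hL hM
    (fun k => by
      rw [hper]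
      ext
      · simp; ring
      · simp)
  refine ⟨i, j, ?_⟩
  simp only [Prod.mk_add_mk, Prod.mk.injEq] at hij
  ext
  · simp [hij.2]
  · simp only [Prod.snd_add]; linarith [hij.1]

/-- A lattice walk that is periodic up to translation by `M • v`, where `2 ≤ M`, has a chord `v`. -/
theorem periodic_chord {v : ℤ × ℤ} (hv : v ≠ 0) {w : ℕ → ℤ × ℤ}
    (hw : ∀ k, lattice.Adj (w k) (w (k + 1))) {L : ℕ} {M : ℤ} (hL : 0 < L) (hM : 2 ≤ M)
    (hper : ∀ k, w (k + L) = w k + M • v) : ∃ i j, w j = w i + v := by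
  obtain ⟨a, b⟩ := v
  have key : ∀ a b : ℤ, 0 < a → 0 ≤ b → ∀ (w : ℕ → ℤ × ℤ),
      (∀ k, lattice.Adj (w k) (w (k + 1))) → ∀ (L : ℕ) (M : ℤ), 0 < L →
      2 ≤ M → (∀ k, w (k + L) = w k + M • (a, b)) → ∃ i j, w j = w i + (a, b) :=
    fun a b ha hb w hw L M hL hM hper =>
      periodic_chord_of_quadrant (v := (a, b)) ha hb hw hL hM hper
  have hab : (0 < a ∧ 0 ≤ b) ∨ (0 < -b ∧ 0 ≤ a) ∨ (0 < -a ∧ 0 ≤ -b) ∨ (0 < b ∧ 0 ≤ -a) := by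
    simp only [ne_eq, Prod.mk_eq_zero] at hv
    omega
  rcases hab with ⟨h1, h2⟩ | ⟨h1, h2⟩ | ⟨h1, h2⟩ | ⟨h1, h2⟩
  · exact key a b h1 h2 w hw L M hL hM hper
  · exact periodic_chord_of_rotate (key _ _ h1 h2) w hw L M hL hM hper
  · exact periodic_chord_of_rotate (periodic_chord_of_rotate (key _ _ h1 h2)) w hw L M hL hM hper
  · refine periodic_chord_of_rotate (periodic_chord_of_rotate (periodic_chord_of_rotate ?_))
      w hw L M hL hM hper
    simpa only [neg_neg] using key b (-a) h1 h2

/-! ### Last points and components -/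

/-- The points of `A` that are last in `A` in the direction `v`. -/
def lastPoints (A : Set (ℤ × ℤ)) (v : ℤ × ℤ) : Set (ℤ × ℤ) :=
  {p | p ∈ A ∧ ∀ k : ℕ, 0 < k → p + k • v ∉ A}

theorem exists_add_smul_mem_lastPoints {A : Set (ℤ × ℤ)} (hA : A.Finite) {v : ℤ × ℤ} (hv : v ≠ 0)
    {p : ℤ × ℤ} (hp : p ∈ A) : ∃ k : ℕ, p + k • v ∈ lastPoints A v := by
  have hinj : Function.Injective fun k : ℕ => p + k • v := fun a b h => by
    have h' : a • v = b • v := add_left_cancel h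
    rw [← natCast_zsmul, ← natCast_zsmul] at h'
    exact_mod_cast smul_left_injective ℤ hv h'
  obtain ⟨k, hk, hmax⟩ := Set.exists_max_image {k : ℕ | p + k • v ∈ A} id
    (hA.preimage hinj.injOn) ⟨0, by simpa using hp⟩
  refine ⟨k, hk, fun m hm hmem => ?_⟩
  have := hmax (k + m) (by
    change p + (k + m) • v ∈ A
    rw [add_smul, ← add_assoc]; exact hmem)
  simp only [id] at this
  omega

theorem eq_of_add_smul_mem_lastPoints {A : Set (ℤ × ℤ)} {v p : ℤ × ℤ} {m n : ℤ}
    (hm : p + m • v ∈ lastPoints A v) (hn : p + n • v ∈ lastPoints A v) : m = n := by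
  rcases lt_trichotomy m n with h | h | h
  · refine absurd hn.1 ?_
    have := hm.2 (n - m).toNat (by omega)
    rwa [← natCast_zsmul, Int.toNat_of_nonneg (by omega), add_assoc, ← add_smul,
      add_sub_cancel] at this
  · exact h
  · refine absurd hm.1 ?_
    have := hn.2 (m - n).toNat (by omega)
    rwa [← natCast_zsmul, Int.toNat_of_nonneg (by omega), add_assoc, ← add_smul,
      add_sub_cancel] at this

/-- From `p`, one reaches in `n` steps through `lastPoints A v` a neighbour of a point `h` of `A`
with `h + v ∉ A` that is not in `lastPoints A v`. -/
def JumpsAfter (A : Set (ℤ × ℤ)) (v : ℤ × ℤ) : ℕ → ℤ × ℤ → Prop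
  | 0, p => ∃ h ∈ A, lattice.Adj p h ∧ h + v ∉ A ∧ h ∉ lastPoints A v
  | n + 1, p => ∃ q ∈ lastPoints A v, lattice.Adj p q ∧ JumpsAfter A v n q

/-- The path must leave the last points, because its end `h` is not one; the count stops at the
first departure. -/
theorem exists_jumpsAfter {A : Set (ℤ × ℤ)} {v p h : ℤ × ℤ} (hp : p ∈ lastPoints A v)
    (hph : Relation.ReflTransGen (fun p q => lattice.Adj p q ∧ q ∈ A ∧ q + v ∉ A) p h)
    (hh : h + (2 : ℕ) • v ∈ A) : ∃ n, JumpsAfter A v n p := by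
  induction hph using Relation.ReflTransGen.head_induction_on with
  | refl => exact absurd hh (hp.2 2 (by norm_num))
  | @head a c hac _ ih =>
    by_cases hc : c ∈ lastPoints A v
    · obtain ⟨n, hn⟩ := ih hc
      exact ⟨n + 1, c, hc, hac.1, hn⟩
    · exact ⟨0, c, hac.2.1, hac.1, hac.2.2, hc⟩

/-- For a finite nonempty set `A` and `v ≠ 0`, some connected component of
`{p ∈ A | p + v ∉ A}` does not meet `A` when it is translated by `2v`. -/
theorem exists_component_add_two_smul_notMem {A : Set (ℤ × ℤ)} (hA : A.Finite) (hne : A.Nonempty)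
    {v : ℤ × ℤ} (hv : v ≠ 0) : ∃ p ∈ A, p + v ∉ A ∧
      ∀ h, Relation.ReflTransGen (fun p q => lattice.Adj p q ∧ q ∈ A ∧ q + v ∉ A) p h →
        h + (2 : ℕ) • v ∉ A := by
  classical
  by_contra! hcon
  let E := lastPoints A v
  -- On `E` the infimum is over a nonempty set, by `exists_jumpsAfter`, so the default value 0 never
  -- arises.
  let rank : ℤ × ℤ → ℕ := fun p => sInf {n | JumpsAfter A v n p}
  have hnext : ∀ p : E, ∃ q : E, ∃ c : ℕ, lattice.Adj (p : ℤ × ℤ) (q - c • v) ∧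
      (c = 0 ∧ rank q < rank p ∨ 2 ≤ c) := by
    rintro ⟨p, hp⟩
    obtain ⟨h, hph, hh⟩ := hcon p hp.1 (by simpa using hp.2 1 one_pos)
    have hrank : JumpsAfter A v (rank p) p := Nat.sInf_mem (exists_jumpsAfter hp hph hh)
    cases hr : rank p with
    | zero =>
      rw [hr] at hrank
      obtain ⟨h, hhA, hadj, hhv, hhE⟩ := hrank
      -- Here `k ≠ 0` since `h` is not last, and `k ≠ 1` since `h + v ∉ A`.
      obtain ⟨k, hk⟩ := exists_add_smul_mem_lastPoints hA hv hhA
      refine ⟨⟨h + k • v, hk⟩, k, by simpa using hadj, Or.inr ?_⟩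
      by_contra! hlt
      interval_cases k
      · exact hhE (by simpa using hk)
      · exact hhv (by simpa using hk.1)
    | succ n =>
      rw [hr] at hrank
      obtain ⟨q, hq, hadj, hn⟩ := hrank
      exact ⟨⟨q, hq⟩, 0, by simpa using hadj,
        Or.inl ⟨rfl, Nat.lt_succ_of_le (Nat.sInf_le hn)⟩⟩
  choose f c hadj hc using hnext
  have : Finite E := (hA.subset fun p hp => hp.1).to_subtype
  obtain ⟨p₀, hp₀⟩ := hne
  obtain ⟨k₀, hk₀⟩ := exists_add_smul_mem_lastPoints hA hv hp₀
  obtain ⟨x, L, hL, hx⟩ : ∃ x : E, ∃ L, 0 < L ∧ f^[L] x = x := by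
    obtain ⟨a, b, hab, heq⟩ := Finite.exists_ne_map_eq_of_infinite
      fun n : ℕ => f^[n] (⟨_, hk₀⟩ : E)
    wlog hlt : a < b generalizing a b
    · exact this b a hab.symm heq.symm (by omega)
    refine ⟨f^[a] ⟨_, hk₀⟩, b - a, by omega, ?_⟩
    rw [← Function.iterate_add_apply, Nat.sub_add_cancel hlt.le]
    exact heq.symm
  let u : ℕ → E := fun t => f^[t] x
  have hu : ∀ t, u (t + 1) = f (u t) := fun t => Function.iterate_succ_apply' f t x
  have hperu : ∀ t, u (t + L) = u t := fun t => by
    simp only [u]; rw [Function.iterate_add_apply, hx]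
  let s : ℕ → ℕ := fun t => ∑ k ∈ Finset.range t, c (u k)
  have hs : ∀ t, s (t + 1) = s t + c (u t) := fun t => Finset.sum_range_succ _ t
  have hpers : ∀ t, s (t + L) = s t + s L := fun t => by
    induction t with
    | zero => simp [s]
    | succ t ih => rw [show t + 1 + L = t + L + 1 by ring, hs, hs, ih, hperu]; ring
  have hgap : ∀ i d, s (i + d) = s i ∨ s i + 2 ≤ s (i + d) := fun i d => by
    induction d with
    | zero => exact Or.inl rfl
    | succ d ih =>
      have h1 := hs (i + d)
      have h2 := hc (u (i + d))
      rw [← add_assoc, h1]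
      omega
  -- A cycle without jumps would strictly decrease `rank` at every step.
  have hsL : 2 ≤ s L := by
    rcases hgap 0 L with h | h
    · exfalso
      rw [zero_add] at h
      have h0 : ∀ k ∈ Finset.range L, c (u k) = 0 := Finset.sum_eq_zero_iff.mp h
      have hdec : ∀ t ≤ L, rank (u t) + t ≤ rank (u 0) := fun t => by
        induction t with
        | zero => intro _; exact le_rfl
        | succ t ih =>
          intro ht
          have h1 := ih (by omega)
          have h2 := hc (u t)
          rw [h0 t (Finset.mem_range.mpr (by omega)), ← hu] at h2
          omega
      have h3 := hdec L le_rfl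
      have h4 := hperu 0
      rw [zero_add] at h4
      rw [h4] at h3
      omega
    · rw [zero_add] at h
      omega
  -- Subtracting the accumulated jumps makes consecutive points adjacent.
  let w : ℕ → ℤ × ℤ := fun t => u t - s t • v
  have hw : ∀ t, lattice.Adj (w t) (w (t + 1)) := fun t => by
    have := lattice_adj_add_right (hadj (u t)) (-(s t • v))
    convert this using 1
    · simp only [w]; abel
    · simp only [w, hs, hu, add_smul]; abel
  obtain ⟨i, j, hij⟩ := periodic_chord (neg_ne_zero.mpr hv) hw (M := (s L : ℤ)) hL
    (by exact_mod_cast hsL) (fun t => by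
      simp only [w, hpers, hperu, add_smul, smul_neg, natCast_zsmul]; abel)
  -- Both points give the last point of the same line in direction `v`, so their multiples of `v`
  -- coincide.
  have hsum : (s j : ℤ) = s i + 1 := by
    have hi : w i + ((s i : ℤ)) • v ∈ lastPoints A v := by
      simp [w, E]
    have hj : w i + ((s j : ℤ) - 1) • v ∈ lastPoints A v := by
      have : w i + ((s j : ℤ) - 1) • v = u j := by
        have h1 : (u j : ℤ × ℤ) = w j + s j • v := by simp [w]
        rw [h1, hij, sub_smul, one_smul, natCast_zsmul]; abel
      rw [this]; exact (u j).2
    linarith [eq_of_add_smul_mem_lastPoints hi hj]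
  rcases le_total i j with h | h
  · obtain ⟨d, rfl⟩ := Nat.exists_eq_add_of_le h
    have := hgap i d
    omega
  · obtain ⟨d, rfl⟩ := Nat.exists_eq_add_of_le h
    have := hgap j d
    omega

/-! ### Unions and connectedness of assemblies -/

theorem induce_connected_dom {G : Type*} {T : Finset (Tile G)} (α : Assembly T) :
    (lattice.induce α.dom).Connected := α.connected

namespace Assembly

variable {G : Type*} {T : Finset (Tile G)}

theorem dom_nonempty (α : Assembly T) : α.dom.Nonempty :=
  Set.nonempty_coe_sort.mp (induce_connected_dom α).nonempty

theorem mem_dom_translate {α : Assembly T} {v p : ℤ × ℤ} :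
    p ∈ (α.translate v).dom ↔ p - v ∈ α.dom := Iff.rfl

theorem tile_translate (α : Assembly T) (v p : ℤ × ℤ) :
    (α.translate v).tile p = α.tile (p - v) := rfl

theorem tile_eq_none {α : Assembly T} {p : ℤ × ℤ} (h : p ∉ α.dom) : α.tile p = none :=
  Option.not_isSome_iff_eq_none.mp h

theorem edgeWeight_congr (str : G → G → ℕ) {α β : Assembly T} {p q p' q' v : ℤ × ℤ}
    (hp : α.tile p = β.tile p') (hq : α.tile q = β.tile q') (hp' : p = p' + v)
    (hq' : q = q' + v) : α.edgeWeight str p q = β.edgeWeight str p' q' := by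
  subst hp' hq'
  unfold edgeWeight
  rw [hp, hq]
  simp only [add_right_comm _ v, add_left_inj]

theorem edgeWeight_comm (str : G → G → ℕ) (α : Assembly T) (p q : ℤ × ℤ) :
    α.edgeWeight str p q = α.edgeWeight str q p := by
  unfold edgeWeight
  obtain ⟨p1, p2⟩ := p
  obtain ⟨q1, q2⟩ := q
  cases hp : α.tile (p1, p2) <;> cases hq : α.tile (q1, q2) <;> simp only
  simp only [Prod.mk_add_mk, Prod.mk.injEq]
  split_ifs <;> first | rfl | omega

theorem StableEdges.symm {str : G → G → ℕ} {τ : ℕ} {α β γ : Assembly T}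
    (h : γ.StableEdges str τ (α.cut β)) : γ.StableEdges str τ (β.cut α) := by
  obtain ⟨F, hF, hτ⟩ := h
  refine ⟨F.map (Equiv.prodComm _ _).toEmbedding, ?_, ?_⟩
  · intro e he
    simp only [Finset.coe_map, Set.mem_image, Finset.mem_coe] at he
    obtain ⟨e', he', rfl⟩ := he
    obtain ⟨h1, h2, h3⟩ := hF he'
    exact ⟨h2, h1, h3.symm⟩
  · rw [Finset.sum_map]
    refine hτ.trans (Finset.sum_le_sum fun e _ => ?_)
    rw [edgeWeight_comm]
    rfl

theorem IsUnion.symm {α β γ : Assembly T} (h : γ.IsUnion α β) : γ.IsUnion β α :=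
  ⟨by rw [h.1, Set.union_comm], h.2.2, h.2.1⟩

/-- Two consistent assemblies whose domains have a connected union have a union. -/
theorem exists_isUnion {α β : Assembly T} (hc : α.Consistent β)
    (h : (lattice.induce (α.dom ∪ β.dom)).Connected) : ∃ γ : Assembly T, γ.IsUnion α β := by
  have hdom : {p | ((α.tile p).or (β.tile p)).isSome} = α.dom ∪ β.dom := by
    ext p
    simp [dom, Option.isSome_or]
  refine ⟨⟨fun p => (α.tile p).or (β.tile p), by rw [hdom]; exact h⟩, hdom, fun p hp => ?_,
    fun p hp => ?_⟩
  · exact Option.or_of_isSome hp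
  · by_cases hpα : p ∈ α.dom
    · rw [← hc p ⟨hpα, hp⟩]
      exact Option.or_of_isSome hpα
    · simp [tile_eq_none hpα]

/-- If a set contains a point of an assembly and, with a point of the assembly, all its neighbours
in the assembly, then it contains the assembly. -/
theorem dom_subset_of_adj_closed {α : Assembly T} {S : Set (ℤ × ℤ)} {p : ℤ × ℤ} (hp : p ∈ α.dom)
    (hpS : p ∈ S) (hS : ∀ a ∈ α.dom, a ∈ S → ∀ b ∈ α.dom, lattice.Adj a b → b ∈ S) :
    α.dom ⊆ S := by
  intro q hq
  obtain ⟨w⟩ := (induce_connected_dom α).preconnected ⟨p, hp⟩ ⟨q, hq⟩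
  have key : ∀ a b : α.dom, (lattice.induce α.dom).Walk a b → (a : ℤ × ℤ) ∈ S →
      (b : ℤ × ℤ) ∈ S := fun a b w => by
    induction w with
    | nil => exact id
    | @cons a c _ hac _ ih => exact fun ha => ih (hS a a.2 ha c c.2 hac)
  exact key _ _ w hpS

/-- At temperature 0 a stable cut may be witnessed by no edge, so the edge is drawn from the
connectedness of `γ`. -/
theorem IsUnion.exists_adj {α β γ : Assembly T} (h : γ.IsUnion α β) (hd : α.Nonoverlapping β) :
    ∃ p ∈ α.dom, ∃ q ∈ β.dom, lattice.Adj p q := by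
  by_contra! hno
  obtain ⟨p, hp⟩ := α.dom_nonempty
  obtain ⟨q, hq⟩ := β.dom_nonempty
  have hsub : γ.dom ⊆ α.dom := by
    refine dom_subset_of_adj_closed (p := p) (by rw [h.1]; exact Or.inl hp) hp
      fun a _ ha b hb hab => ?_
    rw [h.1] at hb
    exact hb.resolve_right fun hb' => hno a ha b hb' hab
  have : q ∈ α.dom ∩ β.dom := ⟨hsub (by rw [h.1]; exact Or.inr hq), hq⟩
  rw [hd] at this
  exact this

end Assembly

/-! ### Growing producible assemblies -/

open Assembly

variable {G : Type*} {𝒯 : HierarchicalTAS G}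

theorem HierarchicalTAS.Producible.finite_dom {α : Assembly 𝒯.tiles} (h : 𝒯.Producible α) :
    α.dom.Finite := by
  induction h with
  | singular γ h => exact Set.finite_of_ncard_ne_zero (by rw [h]; exact one_ne_zero)
  | union α β γ _ _ _ hγ _ ihα ihβ => rw [hγ.1]; exact ihα.union ihβ

theorem HierarchicalTAS.Producible.translate {α : Assembly 𝒯.tiles} (h : 𝒯.Producible α)
    (v : ℤ × ℤ) : 𝒯.Producible (α.translate v) := by
  induction h with
  | singular γ h =>
    refine .singular _ ?_
    obtain ⟨a, ha⟩ := Set.ncard_eq_one.mp h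
    refine Set.ncard_eq_one.mpr ⟨a + v, ?_⟩
    ext p
    rw [mem_dom_translate, ha, Set.mem_singleton_iff, Set.mem_singleton_iff, sub_eq_iff_eq_add]
  | union α β γ _ _ hd hγ hs ihα ihβ =>
    refine .union _ _ _ ihα ihβ ?_ ⟨?_, fun p hp => hγ.2.1 _ hp, fun p hp => hγ.2.2 _ hp⟩ ?_
    · ext p
      have : p - v ∉ α.dom ∩ β.dom := by rw [hd]; exact fun h => h
      exact ⟨fun hp => this hp, fun hp => hp.elim⟩
    · ext p
      rw [mem_dom_translate, hγ.1]
      rfl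
    · obtain ⟨F, hF, hτ⟩ := hs
      refine ⟨F.map ((Equiv.addRight v).prodCongr (Equiv.addRight v)).toEmbedding, ?_, ?_⟩
      · intro e he
        simp only [Finset.coe_map, Set.mem_image, Finset.mem_coe] at he
        obtain ⟨e', he', rfl⟩ := he
        obtain ⟨h1, h2, h3⟩ := hF he'
        refine ⟨?_, ?_, lattice_adj_add_right h3 v⟩
        · simpa [mem_dom_translate] using h1
        · simpa [mem_dom_translate] using h2
      · rw [Finset.sum_map]
        refine hτ.trans (Finset.sum_le_sum fun e _ => le_of_eq ?_)
        refine (edgeWeight_congr _ (v := v) ?_ ?_ rfl rfl).symm <;> simp [tile_translate]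

/-- Let `γ` and `ν` be producible assemblies that overlap consistently. Then `γ` can be extended by
the part of `ν` on any set `S` whose part in `ν` outside `γ` is a union of connected components. -/
theorem HierarchicalTAS.Producible.exists_union_inter {ν : Assembly 𝒯.tiles}
    (hν : 𝒯.Producible ν) {γ : Assembly 𝒯.tiles} (hγ : 𝒯.Producible γ)
    (hov : (γ.dom ∩ ν.dom).Nonempty) (hc : γ.Consistent ν) {S : Set (ℤ × ℤ)}
    (hS : ∀ p ∈ ν.dom, p ∉ γ.dom → p ∈ S → ∀ q ∈ ν.dom, q ∉ γ.dom → lattice.Adj p q → q ∈ S) :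
    ∃ δ : Assembly 𝒯.tiles, 𝒯.Producible δ ∧ δ.dom = γ.dom ∪ (ν.dom ∩ S) ∧
      (∀ p ∈ γ.dom, δ.tile p = γ.tile p) ∧ ∀ p ∈ ν.dom ∩ S, δ.tile p = ν.tile p := by
  induction hν generalizing γ with
  | singular ν h =>
    obtain ⟨a, ha⟩ := Set.ncard_eq_one.mp h
    have hsub : ν.dom ⊆ γ.dom := by
      obtain ⟨b, hb, hb'⟩ := hov
      rw [ha, Set.mem_singleton_iff] at hb'
      rw [ha, Set.singleton_subset_iff, ← hb']
      exact hb
    refine ⟨γ, hγ, ?_, fun _ _ => rfl, fun p hp => hc p ⟨hsub hp.1, hp.1⟩⟩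
    rw [Set.union_eq_left.mpr (Set.inter_subset_left.trans hsub)]
  | union α β ν hα hβ hd hν hs ihα ihβ =>
    wlog hαγ : (γ.dom ∩ α.dom).Nonempty generalizing α β
    · refine this β α hβ hα ?_ hν.symm hs.symm ihβ ihα ?_
      · rw [Nonoverlapping, Set.inter_comm]; exact hd
      · obtain ⟨p, hp, hp'⟩ := hov
        rw [hν.1] at hp'
        exact ⟨p, hp, hp'.resolve_left fun h => hαγ ⟨p, hp, h⟩⟩
    have hdisj : ∀ p ∈ α.dom, p ∉ β.dom := fun p hp hp' => by
      have : p ∈ α.dom ∩ β.dom := ⟨hp, hp'⟩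
      rw [hd] at this
      exact this
    have hαν : α.dom ⊆ ν.dom := by rw [hν.1]; exact Set.subset_union_left
    have hβν : β.dom ⊆ ν.dom := by rw [hν.1]; exact Set.subset_union_right
    -- The half that meets `γ` is attached first; the other half then either meets the result or is
    -- attached whole or not at all.
    obtain ⟨δ, hδ, hδdom, hδγ, hδα⟩ := ihα hγ hαγ
      (fun p hp => by rw [hc p ⟨hp.1, hαν hp.2⟩, hν.2.1 p hp.2])
      (fun p hp hpγ hpS q hq hqγ hpq => hS p (hαν hp) hpγ hpS q (hαν hq) hqγ hpq)
    have hγδ : γ.dom ⊆ δ.dom := by rw [hδdom]; exact Set.subset_union_left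
    have hδβ : δ.Consistent β := by
      rintro p ⟨hp, hpβ⟩
      rw [hδdom] at hp
      rcases hp with hp | hp
      · rw [hδγ p hp, hc p ⟨hp, hβν hpβ⟩, hν.2.2 p hpβ]
      · exact absurd hpβ (hdisj p hp.1)
    have hfinish : ∀ ε : Assembly 𝒯.tiles, 𝒯.Producible ε → ε.dom = δ.dom ∪ (β.dom ∩ S) →
        (∀ p ∈ δ.dom, ε.tile p = δ.tile p) → (∀ p ∈ β.dom ∩ S, ε.tile p = β.tile p) →
        ∃ δ : Assembly 𝒯.tiles, 𝒯.Producible δ ∧ δ.dom = γ.dom ∪ (ν.dom ∩ S) ∧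
          (∀ p ∈ γ.dom, δ.tile p = γ.tile p) ∧ ∀ p ∈ ν.dom ∩ S, δ.tile p = ν.tile p := by
      intro ε hε hεdom hεδ hεβ
      refine ⟨ε, hε, ?_, fun p hp => by rw [hεδ p (hγδ hp), hδγ p hp], ?_⟩
      · rw [hεdom, hδdom, hν.1, Set.union_inter_distrib_right, Set.union_assoc]
      · rintro p ⟨hp, hpS⟩
        rw [hν.1] at hp
        rcases hp with hp | hp
        · rw [hεδ p (by rw [hδdom]; exact Or.inr ⟨hp, hpS⟩), hδα p ⟨hp, hpS⟩, hν.2.1 p hp]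
        · rw [hεβ p ⟨hp, hpS⟩, hν.2.2 p hp]
    by_cases hβδ : (δ.dom ∩ β.dom).Nonempty
    · obtain ⟨ε, hε, hεdom, hεδ, hεβ⟩ := ihβ hδ hβδ hδβ
        (fun p hp hpδ hpS q hq hqδ hpq => hS p (hβν hp) (fun h => hpδ (hγδ h)) hpS q (hβν hq)
          (fun h => hqδ (hγδ h)) hpq)
      exact hfinish ε hε hεdom hεδ hεβ
    have hno : ∀ p ∈ β.dom, p ∉ δ.dom := fun p hp hp' => hβδ ⟨p, hp', hp⟩
    have hnoγ : ∀ p ∈ β.dom, p ∉ γ.dom := fun p hp hp' => hno p hp (hγδ hp')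
    by_cases hβS : (β.dom ∩ S).Nonempty
    · obtain ⟨b, hb, hbS⟩ := hβS
      have hsub : β.dom ⊆ S := dom_subset_of_adj_closed hb hbS
        fun p hp hpS q hq hpq => hS p (hβν hp) (hnoγ p hp) hpS q (hβν hq) (hnoγ q hq) hpq
      -- Since `β` lies in `S` and outside `γ`, closedness of `S` puts every neighbour of `β` in `α`
      -- into `δ`. The entire original cut is thus available for attaching `β`.
      have hcut : ∀ p ∈ α.dom, ∀ q ∈ β.dom, lattice.Adj p q → p ∈ δ.dom := by
        intro p hp q hq hpq
        rw [hδdom]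
        by_cases hpγ : p ∈ γ.dom
        · exact Or.inl hpγ
        · exact Or.inr ⟨hp, hS q (hβν hq) (hnoγ q hq) (hsub hq) p (hαν hp) hpγ hpq.symm⟩
      obtain ⟨a, ha, b', hb', hab⟩ := hν.exists_adj hd
      obtain ⟨ε, hε⟩ := exists_isUnion hδβ (SimpleGraph.connected_induce_union
        (induce_connected_dom δ).preconnected (induce_connected_dom β).preconnected
        (hcut a ha b' hb' hab) hb' hab)
      refine hfinish ε (.union δ β ε hδ hβ (Set.not_nonempty_iff_eq_empty.mp hβδ) hε ?_) ?_
        hε.2.1 (fun p hp => hε.2.2 p hp.1)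
      · obtain ⟨F, hF, hτ⟩ := hs
        refine ⟨F, fun e he => ⟨hcut _ (hF he).1 _ (hF he).2.1 (hF he).2.2, (hF he).2⟩,
          hτ.trans (Finset.sum_le_sum fun e he => le_of_eq ?_)⟩
        obtain ⟨h1, h2, h3⟩ := hF he
        have h1δ := hcut _ h1 _ h2 h3
        refine edgeWeight_congr _ (v := 0) ?_ ?_ (add_zero _).symm (add_zero _).symm
        · rw [hε.2.1 _ h1δ]
          rw [hδdom] at h1δ
          rcases h1δ with h | h
          · rw [hδγ _ h, hc _ ⟨h, hαν h1⟩]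
          · rw [hδα _ h, hν.2.1 _ h1]
        · rw [hε.2.2 _ h2, hν.2.2 _ h2]
      · rw [hε.1, Set.inter_eq_left.mpr hsub]
    · refine hfinish δ hδ ?_ (fun _ _ => rfl) (fun p hp => absurd ⟨p, hp⟩ hβS)
      rw [Set.not_nonempty_iff_eq_empty.mp hβS, Set.union_empty]

/-- A producible repetitious assembly is contained in a larger one. -/
theorem HierarchicalTAS.Producible.exists_larger_repetitious {α : Assembly 𝒯.tiles}
    (hα : 𝒯.Producible α) (hrep : α.Repetitious) :
    ∃ γ : Assembly 𝒯.tiles, 𝒯.Producible γ ∧ γ.Repetitious ∧ α.dom.ncard < γ.dom.ncard := by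
  obtain ⟨v, hv, hov, hc⟩ := hrep
  obtain ⟨p, hp, hpv, hfar⟩ :=
    exists_component_add_two_smul_notMem hα.finite_dom α.dom_nonempty hv
  set r : ℤ × ℤ → ℤ × ℤ → Prop := fun p q => lattice.Adj p q ∧ q ∈ α.dom ∧ q + v ∉ α.dom
  have hD : ∀ h, Relation.ReflTransGen r p h → h ∈ α.dom ∧ h + v ∉ α.dom := fun h hh => by
    rcases Relation.ReflTransGen.cases_tail hh with h | ⟨c, -, hc⟩
    · rw [h]; exact ⟨hp, hpv⟩
    · exact hc.2
  -- This is `D + v`, a component of the part of `α + v` outside `α`.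
  let S : Set (ℤ × ℤ) := {q | Relation.ReflTransGen r p (q - v)}
  have hSα : ∀ q ∈ S, q ∉ α.dom := fun q hq => by
    have := (hD _ hq).2
    rwa [sub_add_cancel] at this
  have hSv : S ⊆ (α.translate v).dom := fun q hq => (hD _ hq).1
  obtain ⟨γ, hγ, hγdom, hγα, hγS⟩ := (hα.translate v).exists_union_inter hα hov hc (S := S)
    (fun a _ _ haS b hb hbα hab => haS.tail ⟨by
      have := lattice_adj_add_right hab (-v)
      rwa [← sub_eq_add_neg, ← sub_eq_add_neg] at this, hb, by rwa [sub_add_cancel]⟩)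
  rw [Set.inter_eq_right.mpr hSv] at hγdom hγS
  have hαγ : α.dom ⊆ γ.dom := by rw [hγdom]; exact Set.subset_union_left
  refine ⟨γ, hγ, ⟨v, hv, ?_, ?_⟩, ?_⟩
  · obtain ⟨q, hq, hq'⟩ := hov
    exact ⟨q, hαγ hq, hαγ hq'⟩
  · rintro q ⟨hq, hq'⟩
    rw [mem_dom_translate] at hq'
    rw [tile_translate]
    rw [hγdom] at hq hq'
    rcases hq' with hq' | hq'
    · rw [hγα _ hq']
      rcases hq with hq | hq
      · rw [hγα _ hq]; exact hc q ⟨hq, hq'⟩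
      · rw [hγS _ hq]; rfl
    -- If `q - v` is a new point, then `q` lies in `D + 2v`, so not in `α`; nor is `q` new, as `q -
    -- v` would then lie in `α`.
    · exfalso
      rcases hq with hq | hq
      · refine hfar _ hq' ?_
        rwa [two_smul, show q - v - v + (v + v) = q by abel]
      · exact hSα _ hq' (hSv hq)
  · refine Set.ncard_lt_ncard ?_ hγ.finite_dom
    have hpS : p + v ∈ S := by
      change Relation.ReflTransGen r p (p + v - v)
      rw [add_sub_cancel_right]
    exact (Set.ssubset_iff_of_subset hαγ).mpr ⟨p + v, by rw [hγdom]; exact Or.inr hpS, hpv⟩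

end TileAssembly

theorem theorem3 {G : Type*} (𝒯 : TileAssembly.HierarchicalTAS G)
    (h : ∃ α : TileAssembly.Assembly 𝒯.tiles, 𝒯.Producible α ∧ α.Repetitious) :
    ∀ n : ℕ, ∃ γ : TileAssembly.Assembly 𝒯.tiles, 𝒯.Producible γ ∧ n < γ.dom.ncard := by
  have key : ∀ n : ℕ, ∃ γ : TileAssembly.Assembly 𝒯.tiles,
      𝒯.Producible γ ∧ γ.Repetitious ∧ n ≤ γ.dom.ncard := fun n => by
    induction n with
    | zero =>
      obtain ⟨α, hα, hrep⟩ := h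
      exact ⟨α, hα, hrep, Nat.zero_le _⟩
    | succ n ih =>
      obtain ⟨α, hα, hrep, hn⟩ := ih
      obtain ⟨γ, hγ, hγrep, hlt⟩ := hα.exists_larger_repetitious hrep
      exact ⟨γ, hγ, hγrep, by omega⟩
  intro n
  obtain ⟨γ, hγ, -, hn⟩ := key (n + 1)
  exact ⟨γ, hγ, hn⟩
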